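/- Let $\mathbb B$ be a compact smooth manifold with boundary, $\dim\mathbb B=n+1$, $n\ge 0$, with a fixed collar neighbourhood $[0,1)\times\partial\mathbb B$ of the boundary with coordinates $(x,y)$. A cut-off function is a function $0\le\omega\in C_c^\infty([0,1))$ with $\omega=1$ near $0$; $\omega=\omega(x)$ is regarded as a function on $\mathbb B$ vanishing outside the collar. For $s,\gamma\in\mathbb R$ and $1\le p<\infty$ let $H^s_p(\mathbb R^{n+1})$ be the Bessel potential space, and define $H^s_{p,loc}(\operatorname{Int}\mathbb B)$ and $H^s_p(\mathbb R\times\partial\mathbb B)$ from it by localization, the first with a smooth atlas of $\operatorname{Int}\mathbb B$ and smooth compactly supported functions in the chart domains, the second with a finite smooth atlas of $\partial\mathbb B$ and a subordinate partition of unity. The cone Sobolev space $\mathcal H^{s,\gamma}_p(\mathbb B)$ consists of all distributions $u\in H^s_{p,loc}(\operatorname{Int}\mathbb B)$ such that for every cut-off function $\omega$ $$S_\gamma(\omega u)\in H^s_p(\mathbb R\times\partial\mathbb B),\qquad (S_\gamma v)(r,y)=e^{(\gamma-\frac{n+1}2)r}\,v(e^{-r},y).$$ For a fixed cut-off function $\omega$,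 its norm $\|u\|_{\mathcal H^{s,\gamma}_p(\mathbb B)}$ is the sum of the norm of $S_\gamma(\omega u)$ in $H^s_p(\mathbb R\times\partial\mathbb B)$ and of the $H^s_p$-norm of $(1-\omega)u$, computed with a finite family of smooth functions that sum to $1-\omega$ on $\operatorname{Int}\mathbb B$, each compactly supported in the domain of a chart of the chosen atlas of $\operatorname{Int}\mathbb B$. Let $1\le p<\infty$, $s>(n+1)/p$ and $\gamma\in\mathbb R$. Then, for all such choices of atlases, partition of unity and norm, there are constants $c\ge0$ and $\delta\in(0,1)$ such that every $u\in\mathcal H^{s,\gamma}_p(\mathbb B)$ is (given by) a continuous function on $\operatorname{Int}\mathbb B$ and satisfies $$|u(x,y)|\le c\,x^{\gamma-\frac{n+1}2}\,\|u\|_{\mathcal H^{s,\gamma}_p(\mathbb B)}\qquad\text{for all }0<x<\delta,\ y\in\partial\mathbb B .$$ In particular, if $\gamma>(n+1)/2$, then $u(x,y)\to0$ as $x\to0^+$, uniformly in $y\in\partial\mathbb B$. -/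

import Mathlib

open scoped Manifold ContDiff ENNReal Distributions SchwartzMap Topology
open MeasureTheory Set Filter

noncomputable section

namespace ConeSobolev

/-- Euclidean space of dimension `d`, with its Euclidean norm. -/
abbrev E (d : ℕ) : Type := EuclideanSpace ℝ (Fin d)

/-- The point `(r, z)` of `ℝ × ℝⁿ`, regarded as a point of `ℝⁿ⁺¹`. -/
def consE {n : ℕ} (r : ℝ) (z : E n) : E (n + 1) :=
  WithLp.toLp 2 (Fin.cons r (fun i => z i) : Fin (n + 1) → ℝ)

/-- The projection `(r, z) ↦ z` from `ℝⁿ⁺¹ = ℝ × ℝⁿ` to `ℝⁿ`. -/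
def tailE {n : ℕ} (w : E (n + 1)) : E n :=
  WithLp.toLp 2 (fun i : Fin n => w i.succ)

@[simp] theorem consE_zero {n : ℕ} (r : ℝ) (z : E n) : consE r z 0 = r := by
  simp [consE]

@[simp] theorem tailE_consE {n : ℕ} (r : ℝ) (z : E n) : tailE (consE r z) = z := by
  ext i; simp [consE, tailE]

@[simp] theorem consE_tailE {n : ℕ} (w : E (n + 1)) : consE (w 0) (tailE w) = w := by
  ext i
  refine Fin.cases ?_ (fun j => ?_) i <;> simp [consE, tailE]

theorem contDiff_consE {n : ℕ} : ContDiff ℝ ∞ (fun q : ℝ × E n => consE q.1 q.2) := by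
  rw [contDiff_euclidean]
  intro i
  refine Fin.cases ?_ (fun j => ?_) i
  · simpa [consE] using contDiff_fst
  · simp only [consE, Fin.cons_succ]
    fun_prop

theorem contDiff_tailE {n : ℕ} : ContDiff ℝ ∞ (tailE : E (n + 1) → E n) := by
  rw [contDiff_euclidean]
  intro i
  simp only [tailE]
  fun_prop

section Manifold

variable (n : ℕ) (B : Type*) [TopologicalSpace B] [ChartedSpace (EuclideanHalfSpace (n + 1)) B]

/-- A smooth chart of the interior of the `(n+1)`-dimensional manifold with boundary `B`: a smooth
diffeomorphism from an open subset of `Int B` onto an open subset of `ℝⁿ⁺¹`. -/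
structure InteriorChart extends OpenPartialHomeomorph B (E (n + 1)) where
  source_subset : source ⊆ (𝓡∂ (n + 1)).interior B
  smooth : ContMDiffOn (𝓡∂ (n + 1)) (𝓡 (n + 1)) ∞ toFun source
  smooth_symm : ContMDiffOn (𝓡 (n + 1)) (𝓡∂ (n + 1)) ∞ invFun target

variable {n B}

/-- The range of a chart, as an open subset of `ℝⁿ⁺¹`. -/
def InteriorChart.range (e : InteriorChart n B) : TopologicalSpace.Opens (E (n + 1)) :=
  ⟨e.target, e.open_target⟩

/-- The transition map from the chart `e` to the chart `e'`, defined on an open subset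
of `ℝⁿ⁺¹`. -/
def InteriorChart.transition (e e' : InteriorChart n B) :
    OpenPartialHomeomorph (E (n + 1)) (E (n + 1)) :=
  e.toOpenPartialHomeomorph.symm.trans e'.toOpenPartialHomeomorph

variable (n B)

/-- A complex-valued (generalized-function type) distribution on `Int B`: a family of
distributions `u_e ∈ 𝓓'(e(U))`, one for every chart `e : U → e(U) ⊆ ℝⁿ⁺¹` of `Int B`, which
transform like functions under a change of charts `τ = e' ∘ e⁻¹`, that is, `u_e = τ^* u_{e'}` on
the overlap: `u_e (|det Dτ| (η' ∘ τ)) = u_{e'} (η')` for all test functions `η'` supported in the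
overlap. -/
structure InteriorDistribution where
  toFun : ∀ e : InteriorChart n B, 𝓓'(e.range, ℂ)
  compat : ∀ (e e' : InteriorChart n B) (η : 𝓓(e.range, ℝ)) (η' : 𝓓(e'.range, ℝ)),
    tsupport η ⊆ (e.transition e').source →
    tsupport η' ⊆ (e.transition e').target →
    (∀ z ∈ (e.transition e').source,
      η z = |(fderiv ℝ (e.transition e') z).det| * η' (e.transition e' z)) →
    toFun e η = toFun e' η'

variable {n B}

/-- The distribution `u` is given by the function `f` on `Int B`. -/
def InteriorDistribution.IsGivenBy (u : InteriorDistribution n B) (f : B → ℂ) : Prop :=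
  ∀ (e : InteriorChart n B) (η : 𝓓(e.range, ℝ)),
    u.toFun e η = ∫ z in (e.range : Set (E (n + 1))), (η z : ℂ) * f (e.symm z)

/-- `T` is the product `w · u_e` of the weight `w` with the representation `u_e` of `u` in the
chart `e`, extended by zero to a tempered distribution on `ℝⁿ⁺¹`. It is used for weights `w` that
are smooth on the range of `e` and such that `w · g` has compact support in the range of `e` for
every `g ∈ C_c^∞(ℝⁿ⁺¹)`; then `T` is unique, since `C_c^∞(ℝⁿ⁺¹)` is dense in the Schwartz
space. -/
def IsWeightedLocalization (u : InteriorDistribution n B) (e : InteriorChart n B)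
    (w : E (n + 1) → ℝ) (T : 𝓢'(E (n + 1), ℂ)) : Prop :=
  ∀ g : 𝓢(E (n + 1), ℂ), HasCompactSupport g → ∀ η : 𝓓(e.range, ℝ),
    (∀ z ∈ e.range, (η z : ℂ) = (w z : ℂ) * g z) → T g = u.toFun e η

/-- `w · u_e`, extended by zero, belongs to the Bessel potential space `H^s_p(ℝⁿ⁺¹)`. -/
def MemSobolevInChart (s : ℝ) (p : ℝ≥0∞) [Fact (1 ≤ p)] (u : InteriorDistribution n B)
    (e : InteriorChart n B) (w : E (n + 1) → ℝ) : Prop :=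
  ∃ T : 𝓢'(E (n + 1), ℂ), IsWeightedLocalization u e w T ∧ TemperedDistribution.MemSobolev s p T

/-- The norm of `w · u_e`, extended by zero, in the Bessel potential space `H^s_p(ℝⁿ⁺¹)`. When
`w · u_e` is in this space, the infimum is taken over a single number. -/
def sobolevNormInChart (s : ℝ) (p : ℝ≥0∞) [Fact (1 ≤ p)] (u : InteriorDistribution n B)
    (e : InteriorChart n B) (w : E (n + 1) → ℝ) : ℝ :=
  sInf {a : ℝ | ∃ (T : 𝓢'(E (n + 1), ℂ)) (f : Lp ℂ p (volume : Measure (E (n + 1)))),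
    IsWeightedLocalization u e w T ∧
    TemperedDistribution.besselPotential (E (n + 1)) ℂ s T = f ∧ a = ‖f‖}

variable (n B) (Y : Type*) [TopologicalSpace Y] [ChartedSpace (E n) Y]

/-- A collar of the boundary of `B`: a diffeomorphism, smooth up to `x = 0`, from `[0,1) × Y` onto
an open neighbourhood of `∂B`, which maps `{0} × Y` onto `∂B`. Thus `Y` is a copy of the
boundary `∂B`, and the points near the boundary have coordinates `(x, y)`. -/
structure Collar extends PartialEquiv (ℝ × Y) B where
  source_eq : source = Ico (0 : ℝ) 1 ×ˢ (univ : Set Y)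
  open_target : IsOpen target
  smooth : ContMDiffOn (𝓘(ℝ, ℝ).prod (𝓡 n)) (𝓡∂ (n + 1)) ∞ toFun source
  smooth_symm : ContMDiffOn (𝓡∂ (n + 1)) (𝓘(ℝ, ℝ).prod (𝓡 n)) ∞ invFun target
  image_zero : toFun '' ({(0 : ℝ)} ×ˢ (univ : Set Y)) = (𝓡∂ (n + 1)).boundary B

variable {n B Y}

/-- The point of `B` with collar coordinates `(x, y)`. -/
def Collar.point (C : Collar n B Y) (x : ℝ) (y : Y) : B := C.toPartialEquiv (x, y)

theorem Collar.mem_source (C : Collar n B Y) {x : ℝ} {y : Y} :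
    (x, y) ∈ C.source ↔ 0 ≤ x ∧ x < 1 := by
  rw [C.source_eq]; simp

theorem exp_neg_mem {r : ℝ} (hr : 0 < r) : 0 ≤ Real.exp (-r) ∧ Real.exp (-r) < 1 :=
  ⟨(Real.exp_pos _).le, by simpa using hr⟩

/-- The first collar coordinate vanishes only on the boundary. -/
theorem Collar.mem_interior (C : Collar n B Y) {b : B}
    (hx : 0 < (C.toPartialEquiv.symm b).1) : b ∈ (𝓡∂ (n + 1)).interior B := by
  rw [← ModelWithCorners.compl_boundary, mem_compl_iff, ← C.image_zero]
  rintro ⟨⟨x, y⟩, ⟨hx0, -⟩, hq⟩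
  have h0 : x = 0 := hx0
  have hs : (x, y) ∈ C.source := C.mem_source.2 (by simp [h0])
  have := C.left_inv hs
  rw [hq] at this
  have h1 : (C.toPartialEquiv.symm b).1 = x := congrArg Prod.fst this
  rw [h1, h0] at hx
  exact lt_irrefl _ hx

/-- For a smooth chart `κ` of `Y`, the chart `(x, y) ↦ (r, κ y)`, `x = e^{-r}`, of `Int B`, defined
on the part `(0,1) × dom κ` of the collar. -/
def Collar.logChart (C : Collar n B Y) (κ : OpenPartialHomeomorph Y (E n))
    (hκ : κ ∈ IsManifold.maximalAtlas (𝓡 n) ∞ Y) : InteriorChart n B :=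
  have hsm : ContMDiffOn (𝓡∂ (n + 1)) (𝓡 (n + 1)) ∞
      (fun b => consE (-Real.log (C.toPartialEquiv.symm b).1) (κ (C.toPartialEquiv.symm b).2))
      (C.target ∩ C.toPartialEquiv.symm ⁻¹' (Ioi (0 : ℝ) ×ˢ κ.source)) := by
    have h0 := C.smooth_symm.mono
      (inter_subset_left (t := C.toPartialEquiv.symm ⁻¹' (Ioi (0 : ℝ) ×ˢ κ.source)))
    have h1 := (contMDiff_fst (I := 𝓘(ℝ, ℝ)) (J := 𝓡 n) (M := ℝ) (N := Y)
      (n := ∞)).comp_contMDiffOn h0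
    have h2 := (contMDiff_snd (I := 𝓘(ℝ, ℝ)) (J := 𝓡 n) (M := ℝ) (N := Y)
      (n := ∞)).comp_contMDiffOn h0
    have hl : ContMDiffOn 𝓘(ℝ, ℝ) 𝓘(ℝ, ℝ) ∞ (fun x : ℝ => -Real.log x) (Ioi 0) :=
      (((Real.contDiffOn_log (n := ∞)).mono (fun x (hx : 0 < x) => hx.ne')).neg).contMDiffOn
    have h3 := hl.comp h1 (fun b hb => hb.2.1)
    have h4 := (contMDiffOn_of_mem_maximalAtlas hκ).comp h2 (fun b hb => hb.2.2)
    exact (contDiff_consE (n := n)).contMDiff.comp_contMDiffOn (h3.prodMk_space h4)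
  have hsm' : ContMDiffOn (𝓡 (n + 1)) (𝓡∂ (n + 1)) ∞
      (fun z : E (n + 1) => C.point (Real.exp (-z 0)) (κ.symm (tailE z)))
      {z | 0 < z 0 ∧ tailE z ∈ κ.target} := by
    have h1 : ContMDiff (𝓡 (n + 1)) 𝓘(ℝ, ℝ) ∞ (fun z : E (n + 1) => Real.exp (-z 0)) := by
      have : ContDiff ℝ ∞ (fun z : E (n + 1) => Real.exp (-z 0)) := by fun_prop
      exact this.contMDiff
    have h2 : ContMDiffOn (𝓡 (n + 1)) (𝓡 n) ∞ (fun z : E (n + 1) => κ.symm (tailE z))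
        {z | 0 < z 0 ∧ tailE z ∈ κ.target} :=
      (contMDiffOn_symm_of_mem_maximalAtlas hκ).comp
        (contDiff_tailE (n := n)).contMDiff.contMDiffOn (fun z hz => hz.2)
    exact C.smooth.comp (h1.contMDiffOn.prodMk h2)
      (fun z hz => C.mem_source.2 (exp_neg_mem hz.1))
  { toFun := fun b =>
      consE (-Real.log (C.toPartialEquiv.symm b).1) (κ (C.toPartialEquiv.symm b).2)
    invFun := fun z => C.point (Real.exp (-z 0)) (κ.symm (tailE z))
    source := C.target ∩ C.toPartialEquiv.symm ⁻¹' (Ioi (0 : ℝ) ×ˢ κ.source)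
    target := {z | 0 < z 0 ∧ tailE z ∈ κ.target}
    map_source' := by
      rintro b ⟨hb, hx, hy⟩
      have h1 : (C.toPartialEquiv.symm b).1 < 1 := (C.mem_source.1 (C.map_target hb)).2
      refine ⟨?_, ?_⟩
      · rw [consE_zero]
        exact neg_pos.2 (Real.log_neg hx h1)
      · rw [tailE_consE]
        exact κ.map_source hy
    map_target' := by
      rintro z ⟨hz, hz'⟩
      have hs : (Real.exp (-z 0), κ.symm (tailE z)) ∈ C.source := C.mem_source.2 (exp_neg_mem hz)
      refine ⟨C.map_source hs, ?_⟩
      rw [mem_preimage, Collar.point, C.left_inv hs]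
      exact ⟨Real.exp_pos _, κ.map_target hz'⟩
    left_inv' := by
      rintro b ⟨hb, hx, hy⟩
      simp only [consE_zero, tailE_consE, neg_neg]
      rw [Real.exp_log hx, κ.left_inv hy]
      exact C.right_inv hb
    right_inv' := by
      rintro z ⟨hz, hz'⟩
      have hs : (Real.exp (-z 0), κ.symm (tailE z)) ∈ C.source := C.mem_source.2 (exp_neg_mem hz)
      simp only [Collar.point]
      rw [C.left_inv hs]
      simp only [Real.log_exp, neg_neg]
      rw [κ.right_inv hz', consE_tailE]
    open_source := C.smooth_symm.continuousOn.isOpen_inter_preimage C.open_target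
      (isOpen_Ioi.prod κ.open_source)
    open_target := (isOpen_Ioi.preimage (by fun_prop : Continuous fun z : E (n + 1) => z 0)).inter
      (κ.open_target.preimage contDiff_tailE.continuous)
    continuousOn_toFun := hsm.continuousOn
    continuousOn_invFun := hsm'.continuousOn
    source_subset := fun b hb => C.mem_interior hb.2.1
    smooth := hsm
    smooth_symm := hsm' }

/-- Cut-off functions near `x = 0`, that is, `0 ≤ θ ∈ C_c^∞([0,1))` with `θ = 1` near `x = 0`. The
function is continued to the real line by `1` on the left and by `0` on the right. -/
structure IsCutoff (θ : ℝ → ℝ) : Prop where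
  smooth : ContDiff ℝ ∞ θ
  nonneg : ∀ x, 0 ≤ θ x
  eq_one : ∃ ε > 0, ∀ x ≤ ε, θ x = 1
  eq_zero : ∃ δ < 1, ∀ x ≥ δ, θ x = 0

/-- The function `θ(x)` on `B`, extended by zero outside the collar. -/
def Collar.cutoff (C : Collar n B Y) (θ : ℝ → ℝ) (b : B) : ℝ := by
  classical
  exact if b ∈ C.target then θ (C.toPartialEquiv.symm b).1 else 0

/-- The choices that enter the definition of Sobolev spaces by localization: a finite smooth atlas
of `Y` with a subordinate partition of unity, a smooth atlas of `Int B`, a cut-off function `θ`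
near the boundary, and a finite family of smooth functions, each one compactly supported in the
domain of a chart of `Int B`, with sum `1 - θ`. The last two are used for the norm only. -/
structure LocalizationData (C : Collar n B Y) where
  ι : Type
  fintype_ι : Fintype ι
  bdryChart : ι → OpenPartialHomeomorph Y (E n)
  bdryChart_mem : ∀ i, bdryChart i ∈ IsManifold.maximalAtlas (𝓡 n) ∞ Y
  part : ι → Y → ℝ
  part_smooth : ∀ i, ContMDiff (𝓡 n) 𝓘(ℝ, ℝ) ∞ (part i)
  part_nonneg : ∀ i y, 0 ≤ part i y
  part_tsupport : ∀ i, tsupport (part i) ⊆ (bdryChart i).source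
  part_sum : ∀ y, ∑ i, part i y = 1
  intCharts : Set (InteriorChart n B)
  intCharts_cover : ∀ b ∈ (𝓡∂ (n + 1)).interior B, ∃ e ∈ intCharts, b ∈ e.source
  θ : ℝ → ℝ
  θ_cutoff : IsCutoff θ
  J : Type
  fintype_J : Fintype J
  intChart : J → InteriorChart n B
  intChart_mem : ∀ j, intChart j ∈ intCharts
  ψ : J → B → ℝ
  ψ_smooth : ∀ j, ContMDiff (𝓡∂ (n + 1)) 𝓘(ℝ, ℝ) ∞ (ψ j)
  ψ_compact : ∀ j, HasCompactSupport (ψ j)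
  ψ_tsupport : ∀ j, tsupport (ψ j) ⊆ (intChart j).source
  ψ_sum : ∀ b ∈ (𝓡∂ (n + 1)).interior B, ∑ j, ψ j b = 1 - C.cutoff θ b

attribute [instance] LocalizationData.fintype_ι LocalizationData.fintype_J

variable {C : Collar n B Y}

/-- The collar chart `(x, y) ↦ (r, κᵢ y)`, `x = e^{-r}`, belonging to the chart `κᵢ` of `Y`. -/
def LocalizationData.collarChart (A : LocalizationData C) (i : A.ι) : InteriorChart n B :=
  C.logChart (A.bdryChart i) (A.bdryChart_mem i)

/-- The weight by which `u` has to be multiplied in the coordinates `(r, z)`, `x = e^{-r}`,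
`z = κᵢ y`, in order to obtain the local representation of `φᵢ S_γ(θ u)`, where
`(S_γ v)(r, y) = e^{(γ - (n+1)/2) r} v(e^{-r}, y)` and `φᵢ` is a function of the partition of unity
on `Y`. -/
def LocalizationData.collarWeight (A : LocalizationData C) (γ : ℝ) (θ : ℝ → ℝ) (i : A.ι)
    (w : E (n + 1)) : ℝ :=
  Real.exp ((γ - ((n : ℝ) + 1) / 2) * w 0) * θ (Real.exp (-w 0)) *
    A.part i ((A.bdryChart i).symm (tailE w))

/-- `u ∈ H^s_{p,loc}(Int B)`: for all charts `e` and all `χ ∈ C_c^∞(dom e)`, the local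
representation of `χ u` belongs to `H^s_p(ℝⁿ⁺¹)`. -/
def MemSobolevLoc (A : LocalizationData C) (s : ℝ) (p : ℝ≥0∞) [Fact (1 ≤ p)]
    (u : InteriorDistribution n B) : Prop :=
  ∀ e ∈ A.intCharts, ∀ χ : B → ℝ, ContMDiff (𝓡∂ (n + 1)) 𝓘(ℝ, ℝ) ∞ χ → HasCompactSupport χ →
    tsupport χ ⊆ e.source → MemSobolevInChart s p u e (fun z => χ (e.symm z))

/-- `S_γ(θ u) ∈ H^s_p(ℝ × Y)`: all the products `φᵢ S_γ(θ u)` with the functions of the partition of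
unity belong to `H^s_p(ℝⁿ⁺¹)` in the coordinates `(r, κᵢ y)`. -/
def MemSobolevCylinder (A : LocalizationData C) (s γ : ℝ) (p : ℝ≥0∞) [Fact (1 ≤ p)]
    (θ : ℝ → ℝ) (u : InteriorDistribution n B) : Prop :=
  ∀ i : A.ι, MemSobolevInChart s p u (A.collarChart i) (A.collarWeight γ θ i)

/-- The cone Sobolev space `𝓗^{s,γ}_p(B)`: all `u ∈ H^s_{p,loc}(Int B)` such that
`S_γ(θ u) ∈ H^s_p(ℝ × ∂B)` for every cut-off function `θ`. -/
def MemConeSobolev (A : LocalizationData C) (s γ : ℝ) (p : ℝ≥0∞) [Fact (1 ≤ p)]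
    (u : InteriorDistribution n B) : Prop :=
  MemSobolevLoc A s p u ∧ ∀ θ : ℝ → ℝ, IsCutoff θ → MemSobolevCylinder A s γ p θ u

/-- The norm of `𝓗^{s,γ}_p(B)`: the `H^s_p`-norm of `S_γ(θ u)` on `ℝ × ∂B` plus the `H^s_p`-norm of
`(1 - θ) u`, both computed by localization. -/
def coneSobolevNorm (A : LocalizationData C) (s γ : ℝ) (p : ℝ≥0∞) [Fact (1 ≤ p)]
    (u : InteriorDistribution n B) : ℝ :=
  ∑ i : A.ι, sobolevNormInChart s p u (A.collarChart i) (A.collarWeight γ A.θ i) +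
    ∑ j : A.J, sobolevNormInChart s p u (A.intChart j) (fun z => A.ψ j ((A.intChart j).symm z))

end Manifold

end ConeSobolev

end

open ConeSobolev

/-
The Bessel potential `(1 - Δ)^{-s/2}` is a superposition of the heat semigroup: by the Gamma
integral, `(1 + ‖ξ‖²)^{-s/2} = Γ(s/2)⁻¹ ∫ t^{s/2-1} e^{-t} e^{-t‖ξ‖²} dt`. The heat kernel has mass
one and maximum `(π/t)^{d/2}`, hence by Jensen's inequality the heat operator maps `L^p` to `L^∞`
with norm at most `(π/t)^{d/(2p)}`. The resulting integral over `t` converges exactly when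
`s > d/p`, which yields the embedding of `H^s_p` into the bounded continuous functions.

Applied in charts, this represents `u` locally by continuous functions; since a continuous
representative is unique, these glue to a continuous function on the interior. In the collar
coordinates `(r, z)`, `x = e^{-r}`, the function whose `H^s_p`-norm is taken is
`x^{-(γ - (n+1)/2)} φᵢ u` near the boundary, so the embedding bounds `φᵢ |u|` by a multiple of
`x^{γ - (n+1)/2}`, and summation over the partition of unity `φᵢ` gives the estimate.
-/

noncomputable section

namespace ConeSobolev

section HeatKernel

open FourierTransform

variable {V F : Type*} [NormedAddCommGroup V] [InnerProductSpace ℝ V] [NormedAddCommGroup F]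

theorem lintegral_mul_enorm_le_of_lintegral_eq_one {α : Type*} {mα : MeasurableSpace α}
    {μ : Measure α} {k : α → ℝ≥0∞} {M p : ℝ≥0∞} {f : α → F} (hk : Measurable k)
    (hk_one : ∫⁻ x, k x ∂μ = 1) (hk_le : ∀ x, k x ≤ M) (hp : 1 ≤ p) (hp' : p ≠ ⊤)
    (hf : AEStronglyMeasurable f μ) :
    ∫⁻ x, k x * ‖f x‖ₑ ∂μ ≤ M ^ (1 / p).toReal * eLpNorm f p μ := by
  have : IsProbabilityMeasure (μ.withDensity k) :=
    ⟨by rw [withDensity_apply _ MeasurableSet.univ, setLIntegral_univ, hk_one]⟩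
  have hle : μ.withDensity k ≤ M • μ :=
    (withDensity_mono (ae_of_all _ hk_le)).trans_eq (withDensity_const M)
  calc ∫⁻ x, k x * ‖f x‖ₑ ∂μ = eLpNorm f 1 (μ.withDensity k) := by
        rw [eLpNorm_one_eq_lintegral_enorm,
          lintegral_withDensity_eq_lintegral_mul₀ hk.aemeasurable hf.enorm]
        rfl
    _ ≤ eLpNorm f p (μ.withDensity k) :=
        eLpNorm_le_eLpNorm_of_exponent_le hp (hf.mono_ac (withDensity_absolutelyContinuous _ _))
    _ ≤ eLpNorm f p (M • μ) := eLpNorm_mono_measure f hle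
    _ = M ^ (1 / p).toReal * eLpNorm f p μ := eLpNorm_smul_measure_of_ne_top hp' f M

/-- The heat kernel at time `t / (4π²)`, that is, the Fourier transform of `ξ ↦ exp (-t ‖ξ‖²)`. -/
def heatKernel (t : ℝ) (y : V) : ℝ :=
  (Real.pi / t) ^ (Module.finrank ℝ V / 2 : ℝ) * Real.exp (-(Real.pi ^ 2 / t) * ‖y‖ ^ 2)

theorem heatKernel_nonneg {t : ℝ} (ht : 0 < t) (y : V) : 0 ≤ heatKernel t y := by
  unfold heatKernel; positivity

theorem heatKernel_le {t : ℝ} (ht : 0 < t) (y : V) :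
    heatKernel t y ≤ (Real.pi / t) ^ (Module.finrank ℝ V / 2 : ℝ) := by
  refine mul_le_of_le_one_right (by positivity) (Real.exp_le_one_iff.2 ?_)
  have : 0 ≤ Real.pi ^ 2 / t * ‖y‖ ^ 2 := by positivity
  linarith

theorem continuous_heatKernel (t : ℝ) : Continuous (heatKernel t : V → ℝ) := by
  unfold heatKernel; fun_prop

variable [FiniteDimensional ℝ V] [MeasurableSpace V] [BorelSpace V]

theorem integral_heatKernel {t : ℝ} (ht : 0 < t) : ∫ y : V, heatKernel t y = 1 := by
  have hinv : Real.pi / t * (Real.pi / (Real.pi ^ 2 / t)) = 1 := by field_simp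
  simp only [heatKernel]
  rw [integral_const_mul, GaussianFourier.integral_rexp_neg_mul_sq_norm (by positivity),
    ← Real.mul_rpow (by positivity) (by positivity), hinv, Real.one_rpow]

theorem lintegral_heatKernel_sub {t : ℝ} (ht : 0 < t) (x : V) :
    ∫⁻ y, ENNReal.ofReal (heatKernel t (x - y)) = 1 := by
  have hint : Integrable (heatKernel t : V → ℝ) :=
    not_imp_comm.1 integral_undef (by simp [integral_heatKernel ht])
  rw [lintegral_sub_left_eq_self (fun y : V => ENNReal.ofReal (heatKernel t y)),
    ← ofReal_integral_eq_lintegral_ofReal hint (ae_of_all _ (heatKernel_nonneg ht)),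
    integral_heatKernel ht, ENNReal.ofReal_one]

theorem norm_integral_heatKernel_smul_le [NormedSpace ℝ F] {t : ℝ} (ht : 0 < t) {p : ℝ≥0∞}
    (hp : 1 ≤ p) (hp' : p ≠ ⊤) {f : V → F} (hf : MemLp f p) (x : V) :
    ‖∫ y, heatKernel t (x - y) • f y‖ ≤
      (Real.pi / t) ^ (Module.finrank ℝ V / (2 * p.toReal)) * (eLpNorm f p).toReal := by
  set M : ℝ := (Real.pi / t) ^ (Module.finrank ℝ V / 2 : ℝ) with hM
  have hM0 : 0 ≤ M := by positivity
  have hmeas : Measurable fun y : V => ENNReal.ofReal (heatKernel t (x - y)) :=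
    ((continuous_heatKernel t).comp (continuous_const.sub continuous_id)).measurable.ennreal_ofReal
  have hle : ‖∫ y, heatKernel t (x - y) • f y‖ₑ ≤
      ENNReal.ofReal M ^ (1 / p).toReal * eLpNorm f p := by
    refine (enorm_integral_le_lintegral_enorm _).trans (le_of_eq_of_le ?_
      (lintegral_mul_enorm_le_of_lintegral_eq_one hmeas (lintegral_heatKernel_sub ht x)
        (fun y => ENNReal.ofReal_le_ofReal (heatKernel_le ht _)) hp hp' hf.1))
    simp only [enorm_smul, Real.enorm_of_nonneg (heatKernel_nonneg ht _)]
  have hexp : (Module.finrank ℝ V / 2 : ℝ) * (1 / p).toReal =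
      Module.finrank ℝ V / (2 * p.toReal) := by
    rw [one_div, ENNReal.toReal_inv, ← div_eq_mul_inv, div_div]
  have htop : ENNReal.ofReal M ^ (1 / p).toReal ≠ ⊤ :=
    ENNReal.rpow_ne_top_of_nonneg ENNReal.toReal_nonneg ENNReal.ofReal_ne_top
  rw [← toReal_enorm, ← hexp, Real.rpow_mul (by positivity), ← hM]
  refine (ENNReal.toReal_mono (ENNReal.mul_ne_top htop hf.eLpNorm_ne_top) hle).trans_eq ?_
  rw [ENNReal.toReal_mul, ← ENNReal.toReal_rpow, ENNReal.toReal_ofReal hM0]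

variable [NormedSpace ℂ F] [CompleteSpace F]

theorem fourierInv_exp_smul_fourier {f : V → F} (hf : Integrable f) {t : ℝ} (ht : 0 < t) (x : V) :
    𝓕⁻ (fun ξ : V => Real.exp (-(t * ‖ξ‖ ^ 2)) • 𝓕 f ξ) x = ∫ y, heatKernel t (x - y) • f y := by
  have hre : 0 < (t : ℂ).re := by simpa
  set G : V → ℂ := fun ξ => Complex.exp (-(t : ℂ) * ‖ξ‖ ^ 2 +
    2 * Real.pi * Complex.I * (inner ℝ x ξ : ℝ)) with hG
  have hGint : Integrable G := GaussianFourier.integrable_cexp_neg_mul_sq_norm_add hre _ x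
  have hGfourier (y : V) : 𝓕 G y = heatKernel t (x - y) := by
    rw [fourier_gaussian_innerProductSpace' hre x y, heatKernel, Complex.ofReal_mul,
      Complex.ofReal_cpow (by positivity)]
    push_cast
    congr 2
    ring
  calc 𝓕⁻ (fun ξ : V => Real.exp (-(t * ‖ξ‖ ^ 2)) • 𝓕 f ξ) x = ∫ ξ, G ξ • 𝓕 f ξ := by
        rw [Real.fourierInv_eq']
        refine integral_congr_ae (ae_of_all _ fun ξ => ?_)
        simp only [hG]
        rw [Complex.exp_add, mul_comm (Complex.exp _), mul_smul, ← Complex.coe_smul,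
          real_inner_comm]
        push_cast
        ring_nf
    _ = ∫ y, 𝓕 G y • f y := by
        simpa using! (VectorFourier.integral_fourierIntegral_smul_eq_flip (L := innerₗ V)
          Real.continuous_fourierChar continuous_inner hGint hf).symm
    _ = ∫ y, heatKernel t (x - y) • f y := by
        simp only [hGfourier, Complex.coe_smul]

end HeatKernel

section BesselPotential

open FourierTransform

theorem one_add_rpow_neg_eq_integral {a σ : ℝ} (ha : 0 ≤ a) (hσ : 0 < σ) :
    (1 + a) ^ (-σ) = (Real.Gamma σ)⁻¹ *
      ∫ t in Ioi (0 : ℝ), Real.exp (-t) * t ^ (σ - 1) * Real.exp (-(t * a)) := by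
  have hΓ : Real.Gamma σ ≠ 0 := (Real.Gamma_pos_of_pos hσ).ne'
  have hexp (t : ℝ) : Real.exp (-t) * t ^ (σ - 1) * Real.exp (-(t * a)) =
      t ^ (σ - 1) * Real.exp (-((1 + a) * t)) := by
    rw [mul_right_comm, ← Real.exp_add, mul_comm]
    ring_nf
  simp only [hexp]
  rw [Real.integral_rpow_mul_exp_neg_mul_Ioi hσ (by positivity), one_div,
    Real.inv_rpow (by positivity), ← Real.rpow_neg (by positivity), mul_comm, mul_assoc,
    mul_inv_cancel₀ hΓ, mul_one]

variable {V F : Type*} [NormedAddCommGroup V] [InnerProductSpace ℝ V] [FiniteDimensional ℝ V]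
  [MeasurableSpace V] [BorelSpace V] [NormedAddCommGroup F]

theorem integrable_gamma_mul_exp_smul [NormedSpace ℝ F] {G : V → F} (hG : Integrable G) {σ : ℝ}
    (hσ : 0 < σ) :
    Integrable (fun q : V × ℝ =>
      (Real.exp (-q.2) * q.2 ^ (σ - 1) * Real.exp (-(q.2 * ‖q.1‖ ^ 2))) • G q.1)
      (volume.prod (volume.restrict (Ioi 0))) := by
  have hbound := hG.norm.mul_prod (Real.GammaIntegral_convergent hσ)
  have hpos : ∀ᵐ q ∂((volume : Measure V).prod (volume.restrict (Ioi (0 : ℝ)))), 0 < q.2 :=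
    Measure.quasiMeasurePreserving_snd.ae (ae_restrict_mem measurableSet_Ioi)
  have hmeas : Measurable fun q : V × ℝ =>
      Real.exp (-q.2) * q.2 ^ (σ - 1) * Real.exp (-(q.2 * ‖q.1‖ ^ 2)) := by fun_prop
  refine hbound.mono' (hmeas.aestronglyMeasurable.smul hG.1.comp_fst) ?_
  filter_upwards [hpos] with q hq
  have hexp : Real.exp (-(q.2 * ‖q.1‖ ^ 2)) ≤ 1 :=
    Real.exp_le_one_iff.2 (neg_nonpos.2 (by positivity))
  rw [norm_smul, Real.norm_of_nonneg (by positivity), mul_comm]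
  exact mul_le_mul_of_nonneg_left (mul_le_of_le_one_right (by positivity) hexp) (norm_nonneg _)

variable [NormedSpace ℂ F] [CompleteSpace F]

theorem fourierInv_one_add_norm_sq_rpow_smul {G : V → F} (hG : Integrable G) {σ : ℝ} (hσ : 0 < σ)
    (x : V) :
    𝓕⁻ (fun ξ : V => (1 + ‖ξ‖ ^ 2) ^ (-σ) • G ξ) x = (Real.Gamma σ)⁻¹ •
      ∫ t in Ioi (0 : ℝ), (Real.exp (-t) * t ^ (σ - 1)) •
        𝓕⁻ (fun ξ : V => Real.exp (-(t * ‖ξ‖ ^ 2)) • G ξ) x := by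
  set χ : V → ℂ := fun ξ => Real.fourierChar (inner ℝ ξ x)
  have hχc : Continuous χ :=
    continuous_subtype_val.comp (Real.continuous_fourierChar.comp (by fun_prop))
  have hχ_norm (ξ : V) : ‖χ ξ‖ = 1 := Circle.norm_coe _
  have hint : Integrable (Function.uncurry fun (ξ : V) (t : ℝ) =>
      χ ξ • (Real.exp (-t) * t ^ (σ - 1) * Real.exp (-(t * ‖ξ‖ ^ 2))) • G ξ)
      (volume.prod (volume.restrict (Ioi 0))) := by
    have hG' := integrable_gamma_mul_exp_smul hG hσ
    refine hG'.mono ((hχc.comp continuous_fst).aestronglyMeasurable.smul hG'.1)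
      (ae_of_all _ fun q => ?_)
    simp [Function.uncurry_def, norm_smul, hχ_norm]
  simp only [Real.fourierInv_eq, Circle.smul_def]
  calc ∫ ξ, χ ξ • (1 + ‖ξ‖ ^ 2) ^ (-σ) • G ξ
      = (Real.Gamma σ)⁻¹ • ∫ ξ, ∫ t in Ioi (0 : ℝ),
          χ ξ • (Real.exp (-t) * t ^ (σ - 1) * Real.exp (-(t * ‖ξ‖ ^ 2))) • G ξ := by
        rw [← integral_smul]
        refine integral_congr_ae (ae_of_all _ fun ξ => ?_)
        simp only
        rw [one_add_rpow_neg_eq_integral (by positivity) hσ, integral_smul, integral_smul_const,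
          mul_smul, smul_comm]
    _ = (Real.Gamma σ)⁻¹ • ∫ t in Ioi (0 : ℝ), ∫ ξ,
          χ ξ • (Real.exp (-t) * t ^ (σ - 1) * Real.exp (-(t * ‖ξ‖ ^ 2))) • G ξ := by
        rw [integral_integral_swap hint]
    _ = (Real.Gamma σ)⁻¹ • ∫ t in Ioi (0 : ℝ), (Real.exp (-t) * t ^ (σ - 1)) •
          ∫ ξ, χ ξ • Real.exp (-(t * ‖ξ‖ ^ 2)) • G ξ := by
        simp only [mul_smul _ (Real.exp _), smul_comm (χ _), integral_smul]

end BesselPotential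

section SobolevEmbedding

open FourierTransform

variable (V : Type*) {F : Type*} [NormedAddCommGroup V] [InnerProductSpace ℝ V]
  [NormedAddCommGroup F]

/-- A bound for the norm of the embedding of the Bessel potential space `H^s_p(V)` into the bounded
continuous functions, where `s > dim V / p`. -/
def sobolevConst (s : ℝ) (p : ℝ≥0∞) : ℝ :=
  Real.pi ^ (Module.finrank ℝ V / (2 * p.toReal)) *
    Real.Gamma (s / 2 - Module.finrank ℝ V / (2 * p.toReal)) / Real.Gamma (s / 2)

variable {V}

theorem sobolevConst_nonneg {s : ℝ} {p : ℝ≥0∞} (hs : Module.finrank ℝ V / p.toReal < s) :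
    0 ≤ sobolevConst V s p := by
  have hs0 : 0 < s / 2 := half_pos (lt_of_le_of_lt (by positivity) hs)
  have hgap : 0 < s / 2 - Module.finrank ℝ V / (2 * p.toReal) := by
    rw [mul_comm, ← div_div]; linarith
  have := Real.Gamma_pos_of_pos hs0
  have := Real.Gamma_pos_of_pos hgap
  unfold sobolevConst; positivity

theorem exp_neg_mul_rpow_mul_div_rpow {a b σ t : ℝ} (hb : 0 ≤ b) (ht : 0 < t) :
    Real.exp (-t) * t ^ (σ - 1) * (b / t) ^ a = b ^ a * (Real.exp (-t) * t ^ (σ - a - 1)) := by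
  rw [Real.div_rpow hb ht.le, show σ - a - 1 = σ - 1 - a by ring,
    Real.rpow_sub ht (σ - 1)]
  ring

variable [FiniteDimensional ℝ V] [MeasurableSpace V] [BorelSpace V] [NormedSpace ℂ F]

theorem norm_fourierInv_one_add_norm_sq_rpow_smul_fourier_le [CompleteSpace F] {s : ℝ} {p : ℝ≥0∞}
    (hp : 1 ≤ p) (hp' : p ≠ ⊤) (hs : Module.finrank ℝ V / p.toReal < s) {f : V → F}
    (hf : Integrable f) (hfp : MemLp f p) (hf' : Integrable (𝓕 f)) (x : V) :
    ‖𝓕⁻ (fun ξ : V => (1 + ‖ξ‖ ^ 2) ^ (-(s / 2)) • 𝓕 f ξ) x‖ ≤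
      sobolevConst V s p * (eLpNorm f p).toReal := by
  set a : ℝ := Module.finrank ℝ V / (2 * p.toReal) with ha
  set N : ℝ := (eLpNorm f p).toReal
  have hs0 : 0 < s / 2 := half_pos (lt_of_le_of_lt (by positivity) hs)
  have hgap : 0 < s / 2 - a := by
    rw [ha, mul_comm, ← div_div]; linarith
  have hΓ := Real.Gamma_pos_of_pos hs0
  have hmaj : IntegrableOn (fun t => Real.pi ^ a * (Real.exp (-t) * t ^ (s / 2 - a - 1)) * N)
      (Ioi 0) :=
    ((Real.GammaIntegral_convergent hgap).const_mul _).mul_const _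
  have hle : ∀ t ∈ Ioi (0 : ℝ), ‖(Real.exp (-t) * t ^ (s / 2 - 1)) •
      𝓕⁻ (fun ξ : V => Real.exp (-(t * ‖ξ‖ ^ 2)) • 𝓕 f ξ) x‖ ≤
      Real.pi ^ a * (Real.exp (-t) * t ^ (s / 2 - a - 1)) * N := by
    intro t (ht : 0 < t)
    rw [fourierInv_exp_smul_fourier hf ht, norm_smul, Real.norm_of_nonneg (by positivity),
      ← exp_neg_mul_rpow_mul_div_rpow Real.pi_pos.le ht, mul_assoc _ (_ ^ a)]
    gcongr
    exact norm_integral_heatKernel_smul_le ht hp hp' hfp x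
  rw [fourierInv_one_add_norm_sq_rpow_smul hf' hs0, norm_smul,
    Real.norm_of_nonneg (inv_nonneg.2 hΓ.le)]
  calc _ ≤ (Real.Gamma (s / 2))⁻¹ *
        ∫ t in Ioi (0 : ℝ), Real.pi ^ a * (Real.exp (-t) * t ^ (s / 2 - a - 1)) * N := by
        gcongr
        exact norm_integral_le_of_norm_le hmaj (ae_restrict_of_forall_mem measurableSet_Ioi hle)
    _ = sobolevConst V s p * N := by
        rw [integral_mul_const, integral_const_mul, ← Real.Gamma_eq_integral hgap, sobolevConst,
          ← ha]
        ring

theorem continuous_integral_smul_boundedContinuousFunction {φ : V → ℂ} (hφ : Integrable φ) :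
    Continuous fun g : BoundedContinuousFunction V F => ∫ x, φ x • g x := by
  have hint (g : BoundedContinuousFunction V F) : Integrable fun x => φ x • g x :=
    (hφ.norm.mul_const ‖g‖).mono' (hφ.1.smul g.continuous.aestronglyMeasurable)
      (ae_of_all _ fun x => (norm_smul _ _).trans_le (by gcongr; exact g.norm_coe_le_norm x))
  refine LipschitzWith.continuous (K := (∫ x, ‖φ x‖).toNNReal) (.of_dist_le_mul fun g h => ?_)
  rw [dist_eq_norm, ← integral_sub (hint g) (hint h), Real.coe_toNNReal _ (by positivity),
    ← integral_mul_const]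
  refine norm_integral_le_of_norm_le (hφ.norm.mul_const _) (ae_of_all _ fun x => ?_)
  rw [← smul_sub, norm_smul, ← dist_eq_norm]
  gcongr
  exact BoundedContinuousFunction.dist_coe_le_dist x

/-- The Bessel potential of order `-s`, from Schwartz functions to bounded continuous functions. -/
def besselPotentialSchwartz (s : ℝ) : 𝓢(V, F) →L[ℂ] BoundedContinuousFunction V F :=
  SchwartzMap.toBoundedContinuousFunctionCLM ℂ V F ∘L
    SchwartzMap.fourierMultiplierCLM F (fun ξ : V => (((1 + ‖ξ‖ ^ 2) ^ (-s / 2) : ℝ) : ℂ))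

theorem norm_besselPotentialSchwartz_le [CompleteSpace F] {s : ℝ} {p : ℝ≥0∞} [Fact (1 ≤ p)]
    (hp : p ≠ ⊤) (hs : Module.finrank ℝ V / p.toReal < s) (f : 𝓢(V, F)) :
    ‖besselPotentialSchwartz s f‖ ≤ sobolevConst V s p * ‖f.toLp p volume‖ := by
  refine (BoundedContinuousFunction.norm_le
    (mul_nonneg (sobolevConst_nonneg hs) (norm_nonneg _))).2 fun x => ?_
  have heq : besselPotentialSchwartz s f x =
      𝓕⁻ (fun ξ : V => (1 + ‖ξ‖ ^ 2) ^ (-(s / 2)) • 𝓕 (f : V → F) ξ) x := by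
    rw [besselPotentialSchwartz, ContinuousLinearMap.comp_apply,
      SchwartzMap.toBoundedContinuousFunctionCLM_apply, SchwartzMap.fourierMultiplierCLM_apply,
      SchwartzMap.fourierInv_coe]
    refine congrArg (fun h : V → F => 𝓕⁻ h x) (funext fun ξ => ?_)
    rw [SchwartzMap.smulLeftCLM_apply_apply (by fun_prop), SchwartzMap.fourier_coe, neg_div,
      Complex.coe_smul]
  rw [heq, SchwartzMap.norm_toLp]
  refine norm_fourierInv_one_add_norm_sq_rpow_smul_fourier_le Fact.out hp hs f.integrable
    (f.memLp p volume) ?_ x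
  rw [← SchwartzMap.fourier_coe]
  exact (𝓕 f).integrable

theorem besselPotential_toLp_apply [CompleteSpace F] (s : ℝ) (p : ℝ≥0∞) [Fact (1 ≤ p)]
    (f : 𝓢(V, F)) (φ : 𝓢(V, ℂ)) :
    TemperedDistribution.besselPotential V F (-s) (f.toLp p volume : Lp F p (volume : Measure V)) φ
      = ∫ x, φ x • besselPotentialSchwartz s f x := by
  rw [Lp.toTemperedDistribution_toLp_eq, TemperedDistribution.besselPotential,
    TemperedDistribution.fourierMultiplierCLM_toTemperedDistributionCLM_eq (by fun_prop),
    SchwartzMap.toTemperedDistributionCLM_apply_apply volume]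
  rfl

theorem exists_boundedContinuousFunction_of_besselPotential_eq [CompleteSpace F] {s : ℝ} {p : ℝ≥0∞}
    [Fact (1 ≤ p)] (hp : p ≠ ⊤) (hs : Module.finrank ℝ V / p.toReal < s) {T : 𝓢'(V, F)}
    {f : Lp F p (volume : Measure V)} (hT : TemperedDistribution.besselPotential V F s T = f) :
    ∃ g : BoundedContinuousFunction V F, ‖g‖ ≤ sobolevConst V s p * ‖f‖ ∧
      ∀ φ : 𝓢(V, ℂ), T φ = ∫ x, φ x • g x := by
  have hdense : DenseRange (SchwartzMap.toLpCLM ℂ F p (volume : Measure V)) :=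
    SchwartzMap.denseRange_toLpCLM hp
  set L : Lp F p (volume : Measure V) →L[ℂ] BoundedContinuousFunction V F :=
    LinearMap.extendOfNorm (besselPotentialSchwartz s).toLinearMap
      (SchwartzMap.toLpCLM ℂ F p (volume : Measure V)).toLinearMap
  have hL (h : 𝓢(V, F)) : L (h.toLp p volume) = besselPotentialSchwartz s h :=
    LinearMap.extendOfNorm_eq hdense ⟨_, norm_besselPotentialSchwartz_le hp hs⟩ h
  refine ⟨L f, LinearMap.norm_extendOfNorm_apply_le hdense _
    (norm_besselPotentialSchwartz_le hp hs) f, fun φ => ?_⟩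
  rw [← (TemperedDistribution.besselPotential_neg_apply_eq_iff s _ _).2 hT]
  have hcont : Continuous fun h : Lp F p (volume : Measure V) =>
      TemperedDistribution.besselPotential V F (-s) (h : 𝓢'(V, F)) φ :=
    (PointwiseConvergenceCLM.evalCLM (RingHom.id ℂ) F φ).continuous.comp
      ((TemperedDistribution.besselPotential V F (-s)).continuous.comp
        (Lp.toTemperedDistributionCLM F (volume : Measure V) p).continuous)
  refine hdense.induction_on f (isClosed_eq hcont
    ((continuous_integral_smul_boundedContinuousFunction φ.integrable).comp L.continuous))
    fun h => ?_
  exact (besselPotential_toLp_apply s p h φ).trans (by rw [← hL h]; rfl)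

end SobolevEmbedding

section TestFunctions

theorem tsupport_indicator_subset_of_eqOn_zero {X M : Type*} [TopologicalSpace X] [Zero M]
    {U K : Set X} (hK : IsClosed K) {φ : X → M} (hφ : EqOn φ 0 (U \ K)) :
    tsupport (U.indicator φ) ⊆ K := by
  refine closure_minimal (fun z hz => ?_) hK
  rw [Function.mem_support, indicator_apply_ne_zero] at hz
  exact by_contra fun hzK => hz.2 (hφ ⟨hz.1, hzK⟩)

section Normed

variable {V F : Type*} [NormedAddCommGroup V] [NormedSpace ℝ V] [NormedAddCommGroup F]
  [NormedSpace ℝ F]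

theorem contDiff_indicator_of_eqOn_zero {m : WithTop ℕ∞} {U K : Set V} (hU : IsOpen U)
    (hK : IsClosed K) (hKU : K ⊆ U) {φ : V → F} (hφ : ContDiffOn ℝ m φ U)
    (h0 : EqOn φ 0 (U \ K)) : ContDiff ℝ m (U.indicator φ) := by
  have hzero : EqOn (U.indicator φ) 0 Kᶜ := fun z hz =>
    image_eq_zero_of_notMem_tsupport fun h => hz (tsupport_indicator_subset_of_eqOn_zero hK h0 h)
  refine contDiff_of_contDiffOn_union_of_isOpen (hφ.congr fun z hz => indicator_of_mem hz φ)
    (contDiffOn_const.congr hzero) ?_ hU hK.isOpen_compl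
  exact eq_univ_of_forall fun z => (em (z ∈ K)).imp (fun h => hKU h) id

theorem exists_testFunction_eqOn {Ω : TopologicalSpace.Opens V} {U K : Set V} (hU : IsOpen U)
    (hK : IsCompact K) (hKU : K ⊆ U) (hKΩ : K ⊆ Ω) {φ : V → F} (hφ : ContDiffOn ℝ ∞ φ U)
    (h0 : EqOn φ 0 (U \ K)) : ∃ η : 𝓓(Ω, F), tsupport η ⊆ K ∧ EqOn η φ U :=
  have hsupp := tsupport_indicator_subset_of_eqOn_zero hK.isClosed h0
  ⟨⟨U.indicator φ, contDiff_indicator_of_eqOn_zero hU hK.isClosed hKU hφ h0,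
    hK.of_isClosed_subset (isClosed_tsupport _) hsupp, hsupp.trans hKΩ⟩, hsupp,
    fun _ hz => indicator_of_mem hz φ⟩

theorem testFunction_sum_apply {Ω : TopologicalSpace.Opens V} {I : Type*} (t : Finset I)
    (ηs : I → 𝓓(Ω, F)) (z : V) : (∑ i ∈ t, ηs i) z = ∑ i ∈ t, ηs i z :=
  map_sum ((Pi.evalAddMonoidHom _ z).comp (FunLike.coeAddMonoidHom 𝓓(Ω, F) V F)) ηs t

theorem det_fderiv_ne_zero (τ : OpenPartialHomeomorph V V) {z : V} (hz : z ∈ τ.source)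
    (hτ : DifferentiableAt ℝ τ z) (hτ' : DifferentiableAt ℝ τ.symm (τ z)) :
    (fderiv ℝ τ z).det ≠ 0 := by
  have hcomp : (fderiv ℝ τ.symm (τ z)).comp (fderiv ℝ τ z) = ContinuousLinearMap.id ℝ V := by
    rw [← fderiv_comp z hτ' hτ, ← fderiv_id (𝕜 := ℝ) (x := z)]
    refine Filter.EventuallyEq.fderiv_eq ?_
    filter_upwards [τ.open_source.mem_nhds hz] with w hw using τ.left_inv hw
  have hdet : (fderiv ℝ τ.symm (τ z)).det * (fderiv ℝ τ z).det = 1 := by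
    rw [ContinuousLinearMap.det, ContinuousLinearMap.det, ← LinearMap.det_comp,
      ← ContinuousLinearMap.toLinearMap_comp, hcomp]
    simp
  exact right_ne_zero_of_mul_eq_one hdet

variable [FiniteDimensional ℝ V]

theorem exists_sum_eq_testFunction {Ω : TopologicalSpace.Opens V} {I : Type*} {U : I → Set V}
    (hU : ∀ i, IsOpen (U i)) (η : 𝓓(Ω, F)) (hη : tsupport η ⊆ ⋃ i, U i) :
    ∃ (t : Finset I) (ηs : t → 𝓓(Ω, F)), (∀ i, tsupport (ηs i) ⊆ U i) ∧ ∑ i, ηs i = η := by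
  obtain ⟨t, ht⟩ := η.hasCompactSupport.isCompact.elim_finite_subcover U hU hη
  obtain ⟨ρ, hρ⟩ := SmoothPartitionOfUnity.exists_isSubordinate 𝓘(ℝ, V) (isClosed_tsupport η)
    (fun i : t => U i) (fun i => hU i) (by simpa [iUnion_subtype] using ht)
  refine ⟨t, fun i => ⟨fun z => ρ i z • η z, (ρ i).contMDiff.contDiff.smul η.contDiff,
    η.hasCompactSupport.smul_left, (tsupport_smul_subset_right _ _).trans η.tsupport_subset⟩,
    fun i => (tsupport_smul_subset_left _ _).trans (hρ i), ?_⟩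
  ext z
  simp only [testFunction_sum_apply, TestFunction.coe_mk, ← Finset.sum_smul]
  by_cases hz : z ∈ tsupport η
  · rw [← finsum_eq_sum_of_fintype, ρ.sum_eq_one hz, one_smul]
  · rw [image_eq_zero_of_notMem_tsupport hz, smul_zero]

theorem contDiff_clm_det {m : WithTop ℕ∞} : ContDiff ℝ m fun L : V →L[ℝ] V => L.det := by
  let b := Module.finBasis ℝ V
  have hdet (L : V →L[ℝ] V) : L.det = ∑ σ : Equiv.Perm (Fin (Module.finrank ℝ V)),
      ((Equiv.Perm.sign σ : ℤ) : ℝ) * ∏ i, b.coord (σ i) (L (b i)) := by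
    rw [ContinuousLinearMap.det, ← LinearMap.det_toMatrix b, Matrix.det_apply']
    simp [LinearMap.toMatrix_apply]
  simp only [hdet]
  refine ContDiff.sum fun σ _ => contDiff_const.mul (contDiff_prod fun i _ => ?_)
  exact (b.coord (σ i)).toContinuousLinearMap.contDiff.comp (contDiff_id.clm_apply contDiff_const)

end Normed

theorem setIntegral_smul_of_tsupport_subset {X F : Type*} [TopologicalSpace X] [MeasurableSpace X]
    {μ : Measure X} [NormedAddCommGroup F] [NormedSpace ℝ F] {η : X → ℝ} {W : Set X}
    (hη : tsupport η ⊆ W) (f : X → F) : ∫ z in W, η z • f z ∂μ = ∫ z, η z • f z ∂μ :=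
  setIntegral_eq_integral_of_forall_compl_eq_zero fun z hz => by
    rw [image_eq_zero_of_notMem_tsupport fun h => hz (hη h), zero_smul]

theorem integrable_smul_of_continuousOn {X F : Type*} [TopologicalSpace X] [MeasurableSpace X]
    [OpensMeasurableSpace X] {μ : Measure X} [IsFiniteMeasureOnCompacts μ] [NormedAddCommGroup F]
    [NormedSpace ℝ F] {η : X → ℝ} (hη : Continuous η) (hc : HasCompactSupport η) {W : Set X}
    (hW : IsOpen W) (hηW : tsupport η ⊆ W) {f : X → F} (hf : ContinuousOn f W) :
    Integrable (fun z => η z • f z) μ :=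
  ((hη.continuousOn.smul hf).continuous_of_tsupport_subset hW
    ((tsupport_smul_subset_left _ _).trans hηW)).integrable_of_hasCompactSupport
    hc.smul_right

variable {V F : Type*} [NormedAddCommGroup V] [NormedSpace ℝ V] [FiniteDimensional ℝ V]
  [MeasurableSpace V] [BorelSpace V] {μ : Measure V} [μ.IsAddHaarMeasure] [NormedAddCommGroup F]
  [NormedSpace ℝ F]

theorem eqOn_of_integral_contDiff_smul_eq [CompleteSpace F] {W : Set V} (hW : IsOpen W)
    {f g : V → F} (hf : ContinuousOn f W) (hg : ContinuousOn g W)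
    (h : ∀ φ : V → ℝ, ContDiff ℝ ∞ φ → HasCompactSupport φ → tsupport φ ⊆ W →
      ∫ z, φ z • f z ∂μ = ∫ z, φ z • g z ∂μ) : EqOn f g W := by
  have hae : ∀ᵐ z ∂μ, z ∈ W → (f - g) z = 0 := by
    refine hW.ae_eq_zero_of_integral_contDiff_smul_eq_zero
      ((hf.sub hg).locallyIntegrableOn hW.measurableSet) fun φ hφ hφc hφW => ?_
    simp only [Pi.sub_apply, smul_sub]
    rw [integral_sub (integrable_smul_of_continuousOn hφ.continuous hφc hW hφW hf)
      (integrable_smul_of_continuousOn hφ.continuous hφc hW hφW hg), h φ hφ hφc hφW, sub_self]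
  refine Measure.eqOn_open_of_ae_eq (μ := μ) ?_ hW hf hg
  rw [Filter.EventuallyEq, ae_restrict_iff' hW.measurableSet]
  filter_upwards [hae] with z hz hzW using sub_eq_zero.1 (hz hzW)

theorem integral_smul_comp_openPartialHomeomorph (τ : OpenPartialHomeomorph V V)
    (hτ : DifferentiableOn ℝ τ τ.source) {η η' : V → ℝ} (hη : tsupport η ⊆ τ.source)
    (hη' : tsupport η' ⊆ τ.target)
    (h : ∀ z ∈ τ.source, η z = |(fderiv ℝ τ z).det| * η' (τ z)) (f : V → F) :
    ∫ z, η z • f (τ z) ∂μ = ∫ w, η' w • f w ∂μ := by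
  have hτ' : ∀ z ∈ τ.source, HasFDerivWithinAt τ (fderiv ℝ τ z) τ.source z := fun z hz =>
    (hτ.differentiableAt (τ.open_source.mem_nhds hz)).hasFDerivAt.hasFDerivWithinAt
  rw [← setIntegral_smul_of_tsupport_subset hη, ← setIntegral_smul_of_tsupport_subset hη',
    ← τ.image_source_eq_target, integral_image_eq_integral_abs_det_fderiv_smul μ
      τ.open_source.measurableSet hτ' τ.injOn]
  refine setIntegral_congr_fun τ.open_source.measurableSet fun z hz => ?_
  simp only [h z hz, mul_smul]

end TestFunctions

section Charts

variable {n : ℕ} {B : Type*} [TopologicalSpace B] [ChartedSpace (EuclideanHalfSpace (n + 1)) B]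

namespace InteriorChart

variable (e e' : InteriorChart n B)

theorem contDiffOn_transition : ContDiffOn ℝ ∞ (e.transition e') (e.transition e').source := by
  rw [← contMDiffOn_iff_contDiffOn]
  exact e'.smooth.comp (e.smooth_symm.mono fun z hz => hz.1) fun z hz => hz.2

theorem transition_symm : (e.transition e').symm = e'.transition e := by
  rw [transition, OpenPartialHomeomorph.trans_symm_eq_symm_trans_symm,
    OpenPartialHomeomorph.symm_symm, transition]

theorem mem_transition_source {z : E (n + 1)} :
    z ∈ (e.transition e').source ↔ z ∈ e.target ∧ e.symm z ∈ e'.source := by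
  simp [transition]

theorem mem_transition_target {z : E (n + 1)} :
    z ∈ (e.transition e').target ↔ z ∈ e'.target ∧ e'.symm z ∈ e.source := by
  rw [← OpenPartialHomeomorph.symm_source, transition_symm, mem_transition_source]

theorem symm_transition {z : E (n + 1)} (hz : z ∈ (e.transition e').source) :
    e'.symm (e.transition e' z) = e.symm z :=
  e'.left_inv ((e.mem_transition_source e').1 hz).2

theorem differentiableAt_transition {z : E (n + 1)} (hz : z ∈ (e.transition e').source) :
    DifferentiableAt ℝ (e.transition e') z :=
  ((e.contDiffOn_transition e').contDiffAt
    ((e.transition e').open_source.mem_nhds hz)).differentiableAt (by simp)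

theorem det_fderiv_transition_ne_zero {z : E (n + 1)} (hz : z ∈ (e.transition e').source) :
    (fderiv ℝ (e.transition e') z).det ≠ 0 := by
  refine det_fderiv_ne_zero _ hz (e.differentiableAt_transition e' hz) ?_
  rw [transition_symm]
  refine e'.differentiableAt_transition e ?_
  rw [← transition_symm, OpenPartialHomeomorph.symm_source]
  exact (e.transition e').map_source hz

theorem contDiffOn_abs_det_fderiv_transition :
    ContDiffOn ℝ ∞ (fun z => |(fderiv ℝ (e.transition e') z).det|) (e.transition e').source := by
  have hdet := contDiff_clm_det.comp_contDiffOn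
    ((e.contDiffOn_transition e').fderiv_of_isOpen (e.transition e').open_source (m := ∞) (by simp))
  exact fun z hz => ((hdet.contDiffAt ((e.transition e').open_source.mem_nhds hz)).abs
    (e.det_fderiv_transition_ne_zero e' hz)).contDiffWithinAt

theorem exists_testFunction_transition (η' : 𝓓(e'.range, ℝ))
    (hη' : tsupport η' ⊆ (e.transition e').target) :
    ∃ η : 𝓓(e.range, ℝ), tsupport η ⊆ (e.transition e').symm '' tsupport η' ∧
      ∀ z ∈ (e.transition e').source,
        η z = |(fderiv ℝ (e.transition e') z).det| * η' (e.transition e' z) := by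
  set τ := e.transition e'
  have hK : IsCompact (τ.symm '' tsupport η') :=
    η'.hasCompactSupport.isCompact.image_of_continuousOn (τ.continuousOn_symm.mono hη')
  have hKτ : τ.symm '' tsupport η' ⊆ τ.source :=
    image_subset_iff.2 fun w hw => τ.map_target (hη' hw)
  refine exists_testFunction_eqOn τ.open_source hK hKτ
    (hKτ.trans fun z hz => ((e.mem_transition_source e').1 hz).1)
    ((e.contDiffOn_abs_det_fderiv_transition e').mul
      (η'.contDiff.comp_contDiffOn (e.contDiffOn_transition e'))) fun z hz => ?_
  have hτz : τ z ∉ tsupport η' := fun h => hz.2 ⟨τ z, h, τ.left_inv hz.1⟩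
  simp [image_eq_zero_of_notMem_tsupport hτz, τ]

end InteriorChart

namespace InteriorDistribution

/-- The distribution `u` is given by the function `f` on the subset `U` of `Int B`. The values of
`f ∘ e⁻¹` outside the range of the chart `e` do not matter, since the test function `η` vanishes
there. -/
def IsGivenOn (u : InteriorDistribution n B) (f : B → ℂ) (U : Set B) : Prop :=
  ∀ (e : InteriorChart n B) (η : 𝓓(e.range, ℝ)), MapsTo e.symm (tsupport η) U →
    u.toFun e η = ∫ z, η z • f (e.symm z)

variable {u : InteriorDistribution n B} {f f' : B → ℂ} {U U' : Set B}

theorem isGivenBy_iff_isGivenOn_interior :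
    u.IsGivenBy f ↔ u.IsGivenOn f ((𝓡∂ (n + 1)).interior B) := by
  have hint (e : InteriorChart n B) (η : 𝓓(e.range, ℝ)) :
      ∫ z in (e.range : Set (E (n + 1))), (η z : ℂ) * f (e.symm z) =
        ∫ z, η z • f (e.symm z) := by
    simp only [← Complex.real_smul]
    exact setIntegral_smul_of_tsupport_subset η.tsupport_subset _
  simp only [IsGivenBy, IsGivenOn, hint]
  exact forall₂_congr fun e η =>
    ⟨fun h _ => h, fun h => h fun z hz => e.source_subset (e.map_target (η.tsupport_subset hz))⟩

theorem isGivenOn_of_chart (e : InteriorChart n B) (hU : U ⊆ e.source)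
    (h : ∀ η : 𝓓(e.range, ℝ), MapsTo e.symm (tsupport η) U →
      u.toFun e η = ∫ z, η z • f (e.symm z)) : u.IsGivenOn f U := by
  intro e' η' hη'
  set τ := e.transition e'
  have hτ' : tsupport η' ⊆ τ.target := fun w hw =>
    (e.mem_transition_target e').2 ⟨η'.tsupport_subset hw, hU (hη' hw)⟩
  obtain ⟨η, hηη', hη⟩ := e.exists_testFunction_transition e' η' hτ'
  have hτ : tsupport η ⊆ τ.source :=
    hηη'.trans (image_subset_iff.2 fun w hw => τ.map_target (hτ' hw))
  have hηU : MapsTo e.symm (tsupport η) U := by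
    intro z hz
    obtain ⟨w, hw, rfl⟩ := hηη' hz
    rw [← e.symm_transition e' (τ.map_target (hτ' hw)), τ.right_inv (hτ' hw)]
    exact hη' hw
  have hfτ (z : E (n + 1)) : η z • f (e.symm z) = η z • f (e'.symm (τ z)) := by
    by_cases hz : z ∈ tsupport η
    · rw [e.symm_transition e' (hτ hz)]
    · simp only [image_eq_zero_of_notMem_tsupport hz, zero_smul]
  rw [← u.compat e e' η η' hτ hτ' hη, h η hηU, integral_congr_ae (ae_of_all _ hfτ)]
  exact integral_smul_comp_openPartialHomeomorph τ
    (fun z hz => (e.differentiableAt_transition e' hz).differentiableWithinAt) hτ hτ' hη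
    fun z => f (e'.symm z)

namespace IsGivenOn

theorem congr (hf : u.IsGivenOn f U) (h : EqOn f f' U) : u.IsGivenOn f' U := by
  intro e η hη
  rw [hf e η hη]
  refine integral_congr_ae (ae_of_all _ fun z => ?_)
  by_cases hz : z ∈ tsupport η
  · simp only [h (hη hz)]
  · simp only [image_eq_zero_of_notMem_tsupport hz, zero_smul]

theorem eqOn (hf : u.IsGivenOn f U) (hf' : u.IsGivenOn f' U') (hU : IsOpen U) (hU' : IsOpen U')
    (hfc : ContinuousOn f U) (hfc' : ContinuousOn f' U') (e : InteriorChart n B) :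
    EqOn f f' (e.source ∩ (U ∩ U')) := by
  have hW : IsOpen (e.target ∩ e.symm ⁻¹' (U ∩ U')) :=
    e.toOpenPartialHomeomorph.isOpen_inter_preimage_symm (hU.inter hU')
  have hsymm : ContinuousOn e.symm (e.target ∩ e.symm ⁻¹' (U ∩ U')) :=
    e.continuousOn_symm.mono inter_subset_left
  have heq : EqOn (f ∘ e.symm) (f' ∘ e.symm) (e.target ∩ e.symm ⁻¹' (U ∩ U')) :=
    eqOn_of_integral_contDiff_smul_eq (μ := volume) hW (hfc.comp hsymm fun z hz => hz.2.1)
      (hfc'.comp hsymm fun z hz => hz.2.2) fun φ hφ hφc hφW =>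
        let η : 𝓓(e.range, ℝ) := ⟨φ, hφ, hφc, hφW.trans inter_subset_left⟩
        (hf e η fun z hz => (hφW hz).2.1).symm.trans (hf' e η fun z hz => (hφW hz).2.2)
  rintro b ⟨hbe, hb⟩
  have hsymm_b : e.symm (e.toOpenPartialHomeomorph b) = b := e.left_inv hbe
  have h := heq ⟨e.map_source hbe, by rwa [mem_preimage, hsymm_b]⟩
  rwa [Function.comp_apply, Function.comp_apply, hsymm_b] at h

theorem iUnion {I : Type*} {U : I → Set B} (hf : ∀ i, u.IsGivenOn f (U i))
    (hU : ∀ i, IsOpen (U i)) (hfc : ContinuousOn f (⋃ i, U i)) : u.IsGivenOn f (⋃ i, U i) := by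
  intro e η hη
  have hW (i : I) : IsOpen (e.target ∩ e.symm ⁻¹' U i) :=
    e.toOpenPartialHomeomorph.isOpen_inter_preimage_symm (hU i)
  obtain ⟨t, ηs, hηs, hsum⟩ := exists_sum_eq_testFunction hW η fun z hz => by
    obtain ⟨i, hi⟩ := mem_iUnion.1 (hη hz)
    exact mem_iUnion.2 ⟨i, η.tsupport_subset hz, hi⟩
  have hint (i : t) : Integrable fun z => ηs i z • f (e.symm z) :=
    integrable_smul_of_continuousOn (ηs i).continuous (ηs i).hasCompactSupport (hW i) (hηs i)
      ((hfc.mono (subset_iUnion U i)).comp (e.continuousOn_symm.mono inter_subset_left)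
        fun z hz => hz.2)
  calc u.toFun e η = ∑ i, ∫ z, ηs i z • f (e.symm z) := by
        rw [← hsum, map_sum]
        exact Finset.sum_congr rfl fun i _ => hf i e (ηs i) fun z hz => (hηs i hz).2
    _ = ∫ z, η z • f (e.symm z) := by
        rw [← integral_finsetSum _ fun i _ => hint i, ← hsum]
        simp only [testFunction_sum_apply, Finset.sum_smul]

end IsGivenOn

end InteriorDistribution

end Charts

section Embedding

variable {n : ℕ} {B : Type*} [TopologicalSpace B] [ChartedSpace (EuclideanHalfSpace (n + 1)) B]

section WeightedLocalization

variable {u : InteriorDistribution n B} {e : InteriorChart n B} {w : E (n + 1) → ℝ}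
  {T : 𝓢'(E (n + 1), ℂ)} {g : E (n + 1) → ℂ}

namespace IsWeightedLocalization

theorem toFun_eq (h : IsWeightedLocalization u e w T)
    (hg : ∀ φ : 𝓢(E (n + 1), ℂ), T φ = ∫ z, φ z • g z) {φ η : 𝓓(e.range, ℝ)}
    (hη : ∀ z ∈ e.range, η z = w z * φ z) : u.toFun e η = ∫ z, φ z • g z := by
  have hφc : HasCompactSupport fun z => (φ z : ℂ) :=
    φ.hasCompactSupport.comp_left (g := Complex.ofReal) Complex.ofReal_zero
  have hφ : ContDiff ℝ ∞ fun z => (φ z : ℂ) := Complex.ofRealCLM.contDiff.comp φ.contDiff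
  rw [← h (hφc.toSchwartzMap hφ) hφc η fun z hz => by
    rw [hη z hz, HasCompactSupport.toSchwartzMap_toFun, Complex.ofReal_mul], hg]
  simp only [HasCompactSupport.toSchwartzMap_toFun, Complex.coe_smul]

theorem isGivenOn (h : IsWeightedLocalization u e w T)
    (hg : ∀ φ : 𝓢(E (n + 1), ℂ), T φ = ∫ z, φ z • g z) {U : Set B} (hU : U ⊆ e.source)
    (hw : ∀ z ∈ e.range, e.symm z ∈ U → w z = 1) :
    u.IsGivenOn (fun b => g (e.toOpenPartialHomeomorph b)) U := by
  refine InteriorDistribution.isGivenOn_of_chart e hU fun η hη => ?_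
  have hηw : ∀ z ∈ e.range, η z = w z * η z := by
    intro z hz
    by_cases hzη : z ∈ tsupport η
    · rw [hw z hz (hη hzη), one_mul]
    · rw [image_eq_zero_of_notMem_tsupport hzη, mul_zero]
  rw [h.toFun_eq hg hηw]
  refine integral_congr_ae (ae_of_all _ fun z => ?_)
  by_cases hzη : z ∈ tsupport η
  · simp only [e.right_inv (η.tsupport_subset hzη)]
  · simp only [image_eq_zero_of_notMem_tsupport hzη, zero_smul]

theorem eqOn (h : IsWeightedLocalization u e w T)
    (hg : ∀ φ : 𝓢(E (n + 1), ℂ), T φ = ∫ z, φ z • g z) (hgc : Continuous g)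
    (hw : ContDiffOn ℝ ∞ w e.range) {f : B → ℂ}
    (hf : u.IsGivenOn f ((𝓡∂ (n + 1)).interior B))
    (hfc : ContinuousOn f ((𝓡∂ (n + 1)).interior B)) :
    EqOn (fun z => w z • f (e.symm z)) g e.range := by
  have hint : MapsTo e.symm e.range ((𝓡∂ (n + 1)).interior B) := fun z hz =>
    e.source_subset (e.map_target hz)
  refine eqOn_of_integral_contDiff_smul_eq (μ := volume) e.range.isOpen
    (hw.continuousOn.smul (hfc.comp e.continuousOn_symm hint)) hgc.continuousOn
    fun φ hφ hφc hφe => ?_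
  have hzero {z : E (n + 1)} (hz : z ∉ tsupport φ) : φ z = 0 := image_eq_zero_of_notMem_tsupport hz
  obtain ⟨η, -, hη⟩ := exists_testFunction_eqOn e.range.isOpen hφc hφe hφe
    (hw.mul hφ.contDiffOn) fun z hz => by simp [hzero hz.2]
  have hu := h.toFun_eq hg (φ := ⟨φ, hφ, hφc, hφe⟩) hη
  refine Eq.trans ?_ ((hf e η (hint.mono_left η.tsupport_subset)).symm.trans hu)
  refine integral_congr_ae (ae_of_all _ fun z => ?_)
  by_cases hz : z ∈ e.range
  · simp only [hη hz, smul_smul, mul_comm]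
  · simp only [hzero fun h => hz (hφe h), zero_smul,
      image_eq_zero_of_notMem_tsupport fun h => hz (η.tsupport_subset h)]

end IsWeightedLocalization

theorem sobolevNormInChart_nonneg (s : ℝ) (p : ℝ≥0∞) [Fact (1 ≤ p)]
    (u : InteriorDistribution n B) (e : InteriorChart n B) (w : E (n + 1) → ℝ) :
    0 ≤ sobolevNormInChart s p u e w := by
  refine Real.sInf_nonneg ?_
  rintro _ ⟨T, f, -, -, rfl⟩
  exact norm_nonneg _

variable {s : ℝ} {p : ℝ≥0∞} [Fact (1 ≤ p)]

theorem norm_weight_smul_le (hp : p ≠ ⊤) (hs : Module.finrank ℝ (E (n + 1)) / p.toReal < s)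
    (hw : ContDiffOn ℝ ∞ w e.range) (hu : MemSobolevInChart s p u e w) {f : B → ℂ}
    (hf : u.IsGivenOn f ((𝓡∂ (n + 1)).interior B))
    (hfc : ContinuousOn f ((𝓡∂ (n + 1)).interior B)) {z : E (n + 1)} (hz : z ∈ e.range) :
    ‖w z • f (e.symm z)‖ ≤ sobolevConst (E (n + 1)) s p * sobolevNormInChart s p u e w := by
  rw [sobolevNormInChart, ← smul_eq_mul, ← Real.sInf_smul_of_nonneg (sobolevConst_nonneg hs)]
  refine le_csInf ?_ ?_
  · obtain ⟨T, hT, F, hF⟩ := hu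
    exact ⟨_, _, ⟨T, F, hT, hF, rfl⟩, rfl⟩
  · rintro _ ⟨_, ⟨T, F, hT, hF, rfl⟩, rfl⟩
    obtain ⟨g, hgF, hg⟩ := exists_boundedContinuousFunction_of_besselPotential_eq hp hs hF
    rw [show w z • f (e.symm z) = g z from hT.eqOn hg g.continuous hw hf hfc hz]
    exact (g.norm_coe_le_norm z).trans hgF

end WeightedLocalization

theorem InteriorDistribution.exists_continuousOn_isGivenOn_interior {u : InteriorDistribution n B}
    (h : ∀ b ∈ (𝓡∂ (n + 1)).interior B, ∃ (e : InteriorChart n B) (U : Set B) (f : B → ℂ),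
      U ⊆ e.source ∧ IsOpen U ∧ b ∈ U ∧ ContinuousOn f U ∧ u.IsGivenOn f U) :
    ∃ f : B → ℂ, ContinuousOn f ((𝓡∂ (n + 1)).interior B) ∧
      u.IsGivenOn f ((𝓡∂ (n + 1)).interior B) := by
  classical
  choose e U F hUe hUo hbU hFc hF using fun b : (𝓡∂ (n + 1)).interior B => h b b.2
  have hUi (b : (𝓡∂ (n + 1)).interior B) : U b ⊆ (𝓡∂ (n + 1)).interior B :=
    (hUe b).trans (e b).source_subset
  let f : B → ℂ := fun b => if hb : b ∈ (𝓡∂ (n + 1)).interior B then F ⟨b, hb⟩ b else 0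
  have hFf (b : (𝓡∂ (n + 1)).interior B) : EqOn (F b) f (U b) := by
    intro b' hb'
    have hi := hUi b hb'
    simp only [f, dif_pos hi]
    exact (hF b).eqOn (hF ⟨b', hi⟩) (hUo _) (hUo _) (hFc _) (hFc _) (e b)
      ⟨hUe b hb', hb', hbU ⟨b', hi⟩⟩
  have hcover : ⋃ b, U b = (𝓡∂ (n + 1)).interior B :=
    (iUnion_subset hUi).antisymm fun b hb => mem_iUnion.2 ⟨⟨b, hb⟩, hbU _⟩
  have hfc : ContinuousOn f (⋃ b, U b) :=
    ContinuousOn.iUnion_of_isOpen (fun b => (hFc b).congr (hFf b).symm) hUo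
  have hf := InteriorDistribution.IsGivenOn.iUnion (fun b => (hF b).congr (hFf b)) hUo hfc
  rw [hcover] at hf hfc
  exact ⟨f, hfc, hf⟩

variable {Y : Type*} [TopologicalSpace Y] [ChartedSpace (E n) Y] {C : Collar n B Y}
  {s : ℝ} {p : ℝ≥0∞} [Fact (1 ≤ p)] {u : InteriorDistribution n B}

theorem MemSobolevLoc.exists_isGivenOn_nhds [T2Space B] [IsManifold (𝓡∂ (n + 1)) ∞ B]
    {A : LocalizationData C} (hp : p ≠ ⊤) (hs : Module.finrank ℝ (E (n + 1)) / p.toReal < s)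
    (hu : MemSobolevLoc A s p u) {b : B} (hb : b ∈ (𝓡∂ (n + 1)).interior B) :
    ∃ (e : InteriorChart n B) (U : Set B) (f : B → ℂ),
      U ⊆ e.source ∧ IsOpen U ∧ b ∈ U ∧ ContinuousOn f U ∧ u.IsGivenOn f U := by
  obtain ⟨e, he, hbe⟩ := A.intCharts_cover b hb
  obtain ⟨χ, -, hχ⟩ := (SmoothBumpFunction.nhds_basis_tsupport (I := 𝓡∂ (n + 1)) b).mem_iff.1
    (e.open_source.mem_nhds hbe)
  obtain ⟨U, hχU, hU, hbU⟩ := eventually_nhds_iff.1 χ.eventuallyEq_one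
  obtain ⟨T, hT, F, hF⟩ := hu e he χ χ.contMDiff χ.hasCompactSupport hχ
  obtain ⟨g, -, hg⟩ := exists_boundedContinuousFunction_of_besselPotential_eq hp hs hF
  exact ⟨e, e.source ∩ U, fun b => g (e.toOpenPartialHomeomorph b), inter_subset_left,
    e.open_source.inter hU, ⟨hbe, hbU⟩,
    g.continuous.comp_continuousOn (e.continuousOn.mono inter_subset_left),
    hT.isGivenOn hg inter_subset_left fun z _ hz => hχU _ hz.2⟩

theorem MemSobolevLoc.exists_continuousOn_isGivenOn [T2Space B] [IsManifold (𝓡∂ (n + 1)) ∞ B]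
    {A : LocalizationData C} (hp : p ≠ ⊤) (hs : Module.finrank ℝ (E (n + 1)) / p.toReal < s)
    (hu : MemSobolevLoc A s p u) :
    ∃ f : B → ℂ, ContinuousOn f ((𝓡∂ (n + 1)).interior B) ∧
      u.IsGivenOn f ((𝓡∂ (n + 1)).interior B) :=
  InteriorDistribution.exists_continuousOn_isGivenOn_interior fun _ hb =>
    hu.exists_isGivenOn_nhds hp hs hb

end Embedding

section Collar

variable {n : ℕ} {B : Type*} [TopologicalSpace B] [ChartedSpace (EuclideanHalfSpace (n + 1)) B]
  {Y : Type*} [TopologicalSpace Y] [ChartedSpace (E n) Y] {C : Collar n B Y}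

theorem Collar.consE_mem_range_logChart {κ : OpenPartialHomeomorph Y (E n)}
    (hκ : κ ∈ IsManifold.maximalAtlas (𝓡 n) ∞ Y) {x : ℝ} (hx : 0 < x) (hx1 : x < 1) {y : Y}
    (hy : y ∈ κ.source) : consE (-Real.log x) (κ y) ∈ (C.logChart κ hκ).range := by
  change 0 < consE (-Real.log x) (κ y) 0 ∧ tailE (consE (-Real.log x) (κ y)) ∈ κ.target
  rw [consE_zero, tailE_consE]
  exact ⟨neg_pos.2 (Real.log_neg hx hx1), κ.map_source hy⟩

theorem Collar.logChart_symm_consE {κ : OpenPartialHomeomorph Y (E n)}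
    (hκ : κ ∈ IsManifold.maximalAtlas (𝓡 n) ∞ Y) {x : ℝ} (hx : 0 < x) {y : Y}
    (hy : y ∈ κ.source) : (C.logChart κ hκ).symm (consE (-Real.log x) (κ y)) = C.point x y := by
  change C.point (Real.exp (-consE (-Real.log x) (κ y) 0))
    (κ.symm (tailE (consE (-Real.log x) (κ y)))) = _
  rw [consE_zero, tailE_consE, neg_neg, Real.exp_log hx, κ.left_inv hy]

namespace LocalizationData

variable (A : LocalizationData C) (γ : ℝ)

theorem collarWeight_consE (θ : ℝ → ℝ) {i : A.ι} {x : ℝ} (hx : 0 < x) {y : Y}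
    (hy : y ∈ (A.bdryChart i).source) :
    A.collarWeight γ θ i (consE (-Real.log x) (A.bdryChart i y)) =
      (x ^ (γ - ((n : ℝ) + 1) / 2))⁻¹ * θ x * A.part i y := by
  rw [collarWeight, consE_zero, tailE_consE, neg_neg, Real.exp_log hx, (A.bdryChart i).left_inv hy,
    ← Real.rpow_neg hx.le, Real.rpow_def_of_pos hx]
  ring_nf

theorem contDiffOn_collarWeight {θ : ℝ → ℝ} (hθ : ContDiff ℝ ∞ θ) (i : A.ι) :
    ContDiffOn ℝ ∞ (A.collarWeight γ θ i) (A.collarChart i).range := by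
  have hcoord : ContDiff ℝ ∞ fun w : E (n + 1) => w 0 := by fun_prop
  have hpart : ContDiffOn ℝ ∞ (fun w : E (n + 1) => A.part i ((A.bdryChart i).symm (tailE w)))
      (A.collarChart i).range := by
    rw [← contMDiffOn_iff_contDiffOn]
    exact (A.part_smooth i).comp_contMDiffOn
      ((contMDiffOn_symm_of_mem_maximalAtlas (A.bdryChart_mem i)).comp
        contDiff_tailE.contMDiff.contMDiffOn fun z hz => hz.2)
  exact (((contDiff_const.mul hcoord).exp.mul (hθ.comp hcoord.neg.exp)).contDiffOn).mul hpart

variable {A γ} {s : ℝ} {p : ℝ≥0∞} [Fact (1 ≤ p)] {u : InteriorDistribution n B} {f : B → ℂ}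

theorem part_mul_norm_point_le (hp : p ≠ ⊤) (hs : Module.finrank ℝ (E (n + 1)) / p.toReal < s)
    {θ : ℝ → ℝ} (hθ : ContDiff ℝ ∞ θ) (hu : MemSobolevCylinder A s γ p θ u)
    (hf : u.IsGivenOn f ((𝓡∂ (n + 1)).interior B))
    (hfc : ContinuousOn f ((𝓡∂ (n + 1)).interior B)) {x : ℝ} (hx : 0 < x) (hx1 : x < 1)
    (hθx : θ x = 1) (y : Y) (i : A.ι) :
    A.part i y * ‖f (C.point x y)‖ ≤
      sobolevConst (E (n + 1)) s p * x ^ (γ - ((n : ℝ) + 1) / 2) *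
        sobolevNormInChart s p u (A.collarChart i) (A.collarWeight γ θ i) := by
  have hxa : 0 < x ^ (γ - ((n : ℝ) + 1) / 2) := Real.rpow_pos_of_pos hx _
  by_cases hy : y ∈ (A.bdryChart i).source
  · have h := norm_weight_smul_le hp hs (A.contDiffOn_collarWeight γ hθ i) (hu i) hf hfc
      (C.consE_mem_range_logChart (A.bdryChart_mem i) hx hx1 hy)
    rw [A.collarWeight_consE γ θ hx hy, hθx, mul_one, collarChart,
      C.logChart_symm_consE (A.bdryChart_mem i) hx hy, norm_smul, Real.norm_of_nonneg
        (mul_nonneg (inv_nonneg.2 hxa.le) (A.part_nonneg i y)), mul_assoc, inv_mul_le_iff₀ hxa] at h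
    rwa [mul_comm (sobolevConst _ _ _), mul_assoc]
  · have hpart : A.part i y = 0 :=
      image_eq_zero_of_notMem_tsupport fun h => hy (A.part_tsupport i h)
    rw [hpart, zero_mul]
    exact mul_nonneg (mul_nonneg (sobolevConst_nonneg hs) hxa.le)
      (sobolevNormInChart_nonneg _ _ _ _ _)

theorem norm_point_le (hp : p ≠ ⊤) (hs : Module.finrank ℝ (E (n + 1)) / p.toReal < s)
    (hu : MemSobolevCylinder A s γ p A.θ u) (hf : u.IsGivenOn f ((𝓡∂ (n + 1)).interior B))
    (hfc : ContinuousOn f ((𝓡∂ (n + 1)).interior B)) {x : ℝ} (hx : 0 < x) (hx1 : x < 1)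
    (hθ : A.θ x = 1) (y : Y) :
    ‖f (C.point x y)‖ ≤ sobolevConst (E (n + 1)) s p * x ^ (γ - ((n : ℝ) + 1) / 2) *
      coneSobolevNorm A s γ p u := by
  have hK := sobolevConst_nonneg hs
  calc ‖f (C.point x y)‖ = ∑ i, A.part i y * ‖f (C.point x y)‖ := by
        rw [← Finset.sum_mul, A.part_sum, one_mul]
    _ ≤ ∑ i, sobolevConst (E (n + 1)) s p * x ^ (γ - ((n : ℝ) + 1) / 2) *
          sobolevNormInChart s p u (A.collarChart i) (A.collarWeight γ A.θ i) :=
        Finset.sum_le_sum fun i _ =>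
          part_mul_norm_point_le hp hs A.θ_cutoff.smooth hu hf hfc hx hx1 hθ y i
    _ ≤ sobolevConst (E (n + 1)) s p * x ^ (γ - ((n : ℝ) + 1) / 2) * coneSobolevNorm A s γ p u := by
        rw [← Finset.mul_sum]
        gcongr
        exact le_add_of_nonneg_right
          (Finset.sum_nonneg fun j _ => sobolevNormInChart_nonneg _ _ _ _ _)

end LocalizationData

end Collar

theorem tendstoUniformly_zero_of_norm_le_rpow {Y F : Type*} [SeminormedAddCommGroup F]
    {G : ℝ → Y → F} {c a δ : ℝ} (ha : 0 < a) (hδ : 0 < δ)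
    (hG : ∀ x ∈ Ioo 0 δ, ∀ y, ‖G x y‖ ≤ c * x ^ a) :
    TendstoUniformly G (fun _ => 0) (𝓝[>] 0) := by
  have hrpow : Tendsto (fun x : ℝ => c * x ^ a) (𝓝[>] 0) (𝓝 0) := by
    have h := ((Real.continuousAt_rpow_const 0 a (Or.inr ha.le)).tendsto.const_mul c).mono_left
      (nhdsWithin_le_nhds (s := Ioi 0))
    rwa [Real.zero_rpow ha.ne', mul_zero] at h
  rw [Metric.tendstoUniformly_iff]
  intro ε hε
  filter_upwards [hrpow.eventually_lt_const hε, Ioo_mem_nhdsGT hδ] with x hx hxδ y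
  rw [dist_zero_left]
  exact (hG x hxδ y).trans_lt hx

end ConeSobolev

end

theorem corollary2p6 {n : ℕ}
    {B : Type*} [TopologicalSpace B] [T2Space B] [CompactSpace B]
    [ChartedSpace (EuclideanHalfSpace (n + 1)) B] [IsManifold (𝓡∂ (n + 1)) ∞ B]
    {Y : Type*} [TopologicalSpace Y] [T2Space Y] [CompactSpace Y]
    [ChartedSpace (EuclideanSpace ℝ (Fin n)) Y] [IsManifold (𝓡 n) ∞ Y]
    (C : Collar n B Y) (A : LocalizationData C)
    (p : ℝ≥0∞) [Fact (1 ≤ p)] (hp : p ≠ ⊤) (s γ : ℝ) (hs : ((n : ℝ) + 1) / p.toReal < s) :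
    ∃ c δ : ℝ, 0 ≤ c ∧ 0 < δ ∧ δ < 1 ∧
      ∀ u : InteriorDistribution n B, MemConeSobolev A s γ p u →
        ∃ f : B → ℂ, ContinuousOn f ((𝓡∂ (n + 1)).interior B) ∧ u.IsGivenBy f ∧
          (∀ x ∈ Ioo (0 : ℝ) δ, ∀ y : Y,
            ‖f (C.point x y)‖ ≤ c * x ^ (γ - ((n : ℝ) + 1) / 2) * coneSobolevNorm A s γ p u) ∧
          (((n : ℝ) + 1) / 2 < γ →
            TendstoUniformly (fun (x : ℝ) (y : Y) => f (C.point x y)) (fun _ => 0)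
              (𝓝[>] (0 : ℝ))) := by
  obtain ⟨ε, hε, hθ⟩ := A.θ_cutoff.eq_one
  have hs' : Module.finrank ℝ (E (n + 1)) / p.toReal < s := by simpa using hs
  have hδ : 0 < min ε (1 / 2) := by positivity
  refine ⟨sobolevConst (E (n + 1)) s p, min ε (1 / 2), sobolevConst_nonneg hs', hδ,
    (min_le_right _ _).trans_lt (by norm_num), fun u hu => ?_⟩
  obtain ⟨f, hfc, hf⟩ := hu.1.exists_continuousOn_isGivenOn hp hs'
  have hbound (x : ℝ) (hx : x ∈ Ioo 0 (min ε (1 / 2))) (y : Y) : ‖f (C.point x y)‖ ≤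
      sobolevConst (E (n + 1)) s p * x ^ (γ - ((n : ℝ) + 1) / 2) * coneSobolevNorm A s γ p u := by
    obtain ⟨hxε, hx1⟩ := lt_min_iff.1 hx.2
    exact LocalizationData.norm_point_le hp hs' (hu.2 A.θ A.θ_cutoff) hf hfc hx.1 (by linarith)
      (hθ x hxε.le) y
  refine ⟨f, hfc, InteriorDistribution.isGivenBy_iff_isGivenOn_interior.2 hf, hbound, fun hγ => ?_⟩
  exact tendstoUniformly_zero_of_norm_le_rpow (sub_pos.2 hγ) hδ fun x hx y =>
    (hbound x hx y).trans_eq (mul_right_comm _ _ _)
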